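/- **Setting.** Let $\mathcal T$ be a commutative semiring (addition $\oplus$, multiplication written by concatenation, zero $\mathbb 0$, unit $\mathbb 1$) with a symmetry, i.e. a map $a\mapsto\ominus a$ of $\mathcal T$ to itself with $\ominus(a\oplus b)=(\ominus a)\oplus(\ominus b)$, $\ominus\mathbb 0=\mathbb 0$, $\ominus(ab)=a(\ominus b)=(\ominus a)b$ and $\ominus(\ominus a)=a$ (the identity map is allowed). Put $a^\circ:=a\oplus(\ominus a)$ and define $$a\preceq b\iff \exists c\in\mathcal T,\ b=a\oplus c,\qquad\qquad a\succeq^\circ b\iff \exists c\in\mathcal T,\ a=b\oplus c^\circ .$$ Let $\mathcal T^*$ be the set of invertible elements of $\mathcal T$. Assume that - $\mathcal T$ is naturally ordered, i.e. $\preceq$ is antisymmetric; - $\mathcal T$ has a modulus: a surjective semiring morphism $a\mapsto|a|$ from $\mathcal T$ onto an idempotent semifield $\mathcal M$ (commutative, with $\mathbb 0\neq\mathbb 1$) that is totally ordered by its natural order $x\preceq y\iff \exists z,\ y=x\oplus z$; - if $|a|\prec|b|$ then $a\oplus b=b$; - if $a\preceq b$, $|a|=|b|$ and $b\in\mathcal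 T^*\cup\{\mathbb 0\}$, then $a=b$; - $a^\circ\oplus a^\circ=a^\circ$ for all $a\in\mathcal T$. (Examples: totally ordered idempotent semifields such as $\mathbb R_{\max}$, the symmetrized max-plus semiring, and the supertropical max-plus semiring.) The sign of a bijection $\sigma:I\to J$ of finite totally ordered sets is $\operatorname{sign}(\sigma)=(\ominus\mathbb 1)^{|\operatorname{inv}(\sigma)|}$, where $\operatorname{inv}(\sigma)=\{(i,j)\in I^2: i<j,\ \sigma(i)>\sigma(j)\}$. For a matrix $A$ over $\mathcal T$ with rows and columns indexed by finite totally ordered sets $I,J$ put $\det(A)=\bigoplus_{\sigma}\operatorname{sign}(\sigma)\prod_{i\in I}A_{i,\sigma(i)}$, the sum being over all bijections $\sigma:I\to J$. For $A\in\mathcal T^{n\times n}$: - $\operatorname{tr}(A)$ is the sum of the diagonal entries, and the same notation is used for square matrices with any finite index set; - $A$ is nonsingular if $\det(A)\in\mathcal T^*$, and then its quasi-inverse is $A^\nabla=\det(A)^{-1}\operatorname{adj}(A)$, where $\operatorname{adj}(A)_{i,j}=(\ominus\mathbb 1)^{i+j}\det(A_{(j,i)})$ and $A_{(j,i)}$ is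 $A$ with row $j$ and column $i$ deleted; - $A^{\wedge k}$ is the $k$-th compound matrix, indexed by the $k$-element subsets $I,J$ of $[n]=\{1,\dots,n\}$, whose $(I,J)$ entry is the determinant of the submatrix of $A$ with rows $I$ and columns $J$. **Theorem.** Let $E,A\in\mathcal T^{n\times n}$ with $E$ nonsingular. Then for every $k\in\{1,\dots,n\}$, $$\operatorname{tr}\big((E^\nabla A E)^{\wedge k}\big)\ \succeq^\circ\ \operatorname{tr}\big(A^{\wedge k}\big).$$ -/

import Mathlib

namespace TropicalCompound

/-- A symmetry of a commutative semiring: an additive involution `opp` (written `⊖` in the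
literature) that is linear over the semiring. The identity map is an example. -/
class SemiringSymmetry (S : Type*) [CommSemiring S] where
  opp : S → S
  opp_add : ∀ a b : S, opp (a + b) = opp a + opp b
  opp_zero : opp 0 = 0
  opp_mul_right : ∀ a b : S, opp (a * b) = a * opp b
  opp_mul_left : ∀ a b : S, opp (a * b) = opp a * b
  opp_opp : ∀ a : S, opp (opp a) = a

open SemiringSymmetry

/-- The natural preorder of a semiring: `a ≼ b` iff `b = a + c` for some `c`. -/
def NatLE {S : Type*} [CommSemiring S] (a b : S) : Prop :=
  ∃ c : S, b = a + c

/-- The strict part of the natural order. -/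
def NatLT {S : Type*} [CommSemiring S] (a b : S) : Prop :=
  NatLE a b ∧ a ≠ b

/-- `S` is naturally ordered: the (always reflexive and transitive) natural preorder is
antisymmetric. -/
def NaturallyOrdered (S : Type*) [CommSemiring S] : Prop :=
  ∀ a b : S, NatLE a b → NatLE b a → a = b

/-- A totally ordered idempotent semifield: addition is idempotent and the natural order is
total. -/
structure IsTotallyOrderedIdempotent (M : Type*) [Semifield M] : Prop where
  add_self : ∀ a : M, a + a = a
  total : ∀ a b : M, NatLE a b ∨ NatLE b a

section Symmetry

variable {S : Type*} [CommSemiring S] [SemiringSymmetry S]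

/-- The balanced element `a° = a ⊖ a`. -/
def circ (a : S) : S := a + opp a

/-- The relation `a ⪰° b`: `a = b ⊕ d` for some `d` of the form `c°`. -/
def SuccCirc (a b : S) : Prop :=
  ∃ c : S, a = b + circ c

/-- The sign `(⊖1)^{|inv σ|}` of a bijection between two finite totally ordered sets, `inv σ`
being the set of inversions of `σ`. -/
def bijSign (S : Type*) [CommSemiring S] [SemiringSymmetry S]
    {α β : Type*} [Fintype α] [LinearOrder α] [LinearOrder β] (σ : α ≃ β) : S :=
  (opp (1 : S)) ^ (Finset.univ.filter fun p : α × α => p.1 < p.2 ∧ σ p.2 < σ p.1).card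

/-- The signed sum over all bijections from the row set to the column set of a matrix whose row
and column sets are finite and totally ordered. For a square matrix (`α = β`) this is the
determinant; for a submatrix it is the corresponding minor. -/
def det {α β : Type*} [Fintype α] [LinearOrder α] [Fintype β] [LinearOrder β]
    (A : Matrix α β S) : S :=
  ∑ σ : α ≃ β, bijSign S σ * ∏ i : α, A i (σ i)

/-- A square matrix is nonsingular when its determinant is invertible in `S`. -/
def Nonsingular {n : ℕ} (A : Matrix (Fin n) (Fin n) S) : Prop :=
  IsUnit (det A)

/-- The submatrix obtained by deleting row `r` and column `c`. -/
def deleteRowCol {n : ℕ} (A : Matrix (Fin n) (Fin n) S) (r c : Fin n) :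
    Matrix {i : Fin n // i ≠ r} {j : Fin n // j ≠ c} S :=
  A.submatrix Subtype.val Subtype.val

/-- The adjoint matrix: `adj(A)_{i,j} = (⊖1)^{i+j} det(A_{(j,i)})`. Numbering rows and columns
from `0` instead of `1` does not change the parity of `i + j`. -/
def adj {n : ℕ} (A : Matrix (Fin n) (Fin n) S) : Matrix (Fin n) (Fin n) S :=
  Matrix.of fun i j => (opp (1 : S)) ^ ((i : ℕ) + (j : ℕ)) * det (deleteRowCol A j i)

/-- The quasi-inverse `A^∇ = adj(A) det(A)⁻¹` of a nonsingular matrix. -/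
noncomputable def quasiInverse {n : ℕ} (A : Matrix (Fin n) (Fin n) S) (hA : Nonsingular A) :
    Matrix (Fin n) (Fin n) S :=
  Matrix.of fun i j => adj A i j * ((IsUnit.unit hA)⁻¹ : Sˣ)

/-- The `k`-th compound matrix, indexed by the `k`-element subsets of the index set:
its `(I, J)` entry is the `I × J` minor of `A`. -/
def compound {n : ℕ} (A : Matrix (Fin n) (Fin n) S) (k : ℕ) :
    Matrix {I : Finset (Fin n) // I.card = k} {J : Finset (Fin n) // J.card = k} S :=
  Matrix.of fun I J => det (A.submatrix (fun i : I.1 => i.1) (fun j : J.1 => j.1))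

end Symmetry

/-- The standing assumptions on a semiring `T` with symmetry and a map `μ : T → M`, `μ a = |a|`:
`M` is a totally ordered idempotent semifield, `T` is naturally ordered, `μ` is a modulus
(a surjective morphism of semirings), and the three structural properties of extended tropical
semirings hold. -/
structure IsExtendedTropical {T M : Type*} [CommSemiring T] [SemiringSymmetry T] [Semifield M]
    (μ : T →+* M) : Prop where
  semifield : IsTotallyOrderedIdempotent M
  naturallyOrdered : NaturallyOrdered T
  surjective : Function.Surjective μ
  absorb : ∀ a b : T, NatLT (μ a) (μ b) → a + b = b
  thin : ∀ a b : T, NatLE a b → μ a = μ b → (IsUnit b ∨ b = 0) → a = b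
  circ_idem : ∀ a : T, circ a + circ a = circ a

end TropicalCompound

/-!
The inequality is obtained from an identity over commutative rings. Over a ring the sum of the
principal `k`-minors is, up to sign, a coefficient of the characteristic polynomial, so
`charpoly (M * N) = charpoly (N * M)` and `A * E * adj E = det E • A` give
`tr ((adj E * A * E)^{∧k}) = det E ^ k * tr (A^{∧k})` (`trace_compound_adj_mul_mul`).

To transfer it to a semiring with symmetry, both sides are computed with matrices of variables in
`SignedSum G`, the formal sums of signed monomials, which maps to the ring `ℤ[G]` and, by
evaluation, to the given semiring. If `P` and `Q` agree in `ℤ[G]` and `Q₀` is what remains of `Q`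
after the cancellation of opposite terms, then `P = Q₀ + c°` (`SignedSum.exists_reduced`). It
remains to see that, for `Q = det E ^ k * tr (A^{∧k})`, the cancelled terms do not matter after
evaluation. They exist in general (already for `k = n = 3`), and it is here that invertibility of
the determinant is used: by the modulus and the thinness axiom, a term `t` of maximal modulus of
`det E` evaluates to `det E` itself (`IsExtendedTropical.exists_term_eq_det`). The terms of
`t ^ k * tr (A^{∧k})` are not cancelled in `Q`, because their monomials determine their sign
(`coeff_det_pow_mul_trace_eq_zero`). So `Q₀` lies, in the natural order, between
`t ^ k * tr (A^{∧k})` and `Q`, which have the same value; as the order is antisymmetric, `Q₀` has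
that value too. Dividing by `det E ^ k` gives the claim.
-/

open TropicalCompound SemiringSymmetry

namespace TropicalCompound

/-! ### Symmetries and functoriality -/

section Symmetry

variable {S S' : Type*} [CommSemiring S] [SemiringSymmetry S] [CommSemiring S']
  [SemiringSymmetry S']

lemma opp_eq_mul (a : S) : opp a = opp 1 * a := by
  rw [← opp_mul_left, one_mul]

lemma opp_one_mul_self : opp (1 : S) * opp 1 = 1 := by
  rw [← opp_eq_mul, opp_opp]

lemma map_opp (φ : S →+* S') (hφ : φ (opp 1) = opp 1) (a : S) : φ (opp a) = opp (φ a) := by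
  rw [opp_eq_mul, map_mul, hφ, ← opp_eq_mul]

lemma map_circ (φ : S →+* S') (hφ : φ (opp 1) = opp 1) (a : S) : φ (circ a) = circ (φ a) := by
  rw [circ, map_add, map_opp φ hφ, circ]

lemma mul_circ (a b : S) : a * circ b = circ (a * b) := by
  rw [circ, mul_add, ← opp_mul_right, circ]

variable (S) in
/-- The morphism from the group of signs to `S` that sends `-1` to `⊖1`. -/
def signHom : ℤˣ →* S where
  toFun u := if u = 1 then 1 else opp 1
  map_one' := if_pos rfl
  map_mul' u v := by
    rcases Int.units_eq_one_or u with rfl | rfl <;> rcases Int.units_eq_one_or v with rfl | rfl <;>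
      simp [opp_one_mul_self]

lemma signHom_neg_one : signHom S (-1) = opp 1 := by simp [signHom]

section Det

variable {α β : Type*} [Fintype α] [LinearOrder α] [LinearOrder β]

/-- The sign of a bijection as an element of the group `{1, -1}`. -/
def inversionSign (σ : α ≃ β) : ℤˣ :=
  (-1) ^ (Finset.univ.filter fun p : α × α => p.1 < p.2 ∧ σ p.2 < σ p.1).card

lemma bijSign_eq (σ : α ≃ β) : bijSign S σ = signHom S (inversionSign σ) := by
  rw [inversionSign, map_pow, signHom_neg_one, bijSign]

variable [Fintype β]

lemma map_det (φ : S →+* S') (hφ : φ (opp 1) = opp 1) (A : Matrix α β S) :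
    φ (det A) = det (A.map φ) := by
  simp [det, bijSign, hφ]

lemma det_submatrix_orderIso {α' β' : Type*} [Fintype α'] [LinearOrder α'] [Fintype β']
    [LinearOrder β'] (e : α' ≃o α) (f : β' ≃o β) (A : Matrix α β S) :
    det (A.submatrix e f) = det A := by
  refine Fintype.sum_equiv (Equiv.equivCongr e.toEquiv f.toEquiv) _ _ fun σ => ?_
  congr 1
  · unfold bijSign
    congr 1
    refine Finset.card_equiv (Equiv.prodCongr e.toEquiv e.toEquiv) fun p => ?_
    simp
  · refine Fintype.prod_equiv e.toEquiv _ _ fun i => ?_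
    simp

end Det

variable {n : ℕ}

lemma map_adj (φ : S →+* S') (hφ : φ (opp 1) = opp 1) (A : Matrix (Fin n) (Fin n) S) :
    (adj A).map φ = adj (A.map φ) := by
  ext i j
  simp [adj, deleteRowCol, map_det φ hφ, hφ, Matrix.submatrix_map]

lemma map_trace_compound (φ : S →+* S') (hφ : φ (opp 1) = opp 1) (A : Matrix (Fin n) (Fin n) S)
    (k : ℕ) : φ (compound A k).trace = (compound (A.map φ) k).trace := by
  simp [Matrix.trace, compound, map_det φ hφ, Matrix.submatrix_map]

lemma trace_compound_smul (c : S) (A : Matrix (Fin n) (Fin n) S) (k : ℕ) :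
    (compound (c • A) k).trace = c ^ k * (compound A k).trace := by
  simp only [Matrix.trace, Finset.mul_sum, Matrix.diag_apply, compound, Matrix.of_apply, det]
  refine Finset.sum_congr rfl fun I _ => Finset.sum_congr rfl fun σ _ => ?_
  simp only [Matrix.submatrix_apply, Matrix.smul_apply, smul_eq_mul, Finset.prod_mul_distrib,
    Finset.prod_const, Finset.card_univ, Fintype.card_coe, I.2]
  ring

end Symmetry

/-! ### The identity over commutative rings -/

section Ring

/-- A commutative ring with its negation is a semiring with symmetry. -/
instance ringSymmetry (R : Type*) [CommRing R] : SemiringSymmetry R where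
  opp := Neg.neg
  opp_add := neg_add
  opp_zero := neg_zero
  opp_mul_right a b := (mul_neg a b).symm
  opp_mul_left a b := (neg_mul a b).symm
  opp_opp := neg_neg

variable {R : Type*} [CommRing R]

lemma opp_one_eq_neg_one : opp (1 : R) = -1 := rfl

lemma inversionSign_eq_sign {m : ℕ} (σ : Equiv.Perm (Fin m)) :
    inversionSign σ = Equiv.Perm.sign σ := by
  rw [Equiv.Perm.sign_eq_prod_prod_Ioi, inversionSign, Finset.prod_sigma', Finset.prod_ite]
  rw [Finset.prod_const_one, one_mul, Finset.prod_const]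
  congr 1
  refine Finset.card_bij' (fun p _ => ⟨p.1, p.2⟩) (fun p _ => (p.1, p.2)) ?_ ?_ ?_ ?_
  · rintro ⟨i, j⟩ h
    simp at h ⊢
    exact ⟨h.1, h.2.le⟩
  · rintro ⟨i, j⟩ h
    simp at h ⊢
    exact ⟨h.1, lt_of_le_of_ne h.2 fun e => h.1.ne' (σ.injective e)⟩
  · simp
  · simp

lemma det_eq_matrix_det_fin {m : ℕ} (A : Matrix (Fin m) (Fin m) R) : det A = A.det := by
  rw [← Matrix.det_transpose, Matrix.det_apply', det]
  refine Finset.sum_congr rfl fun σ _ => ?_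
  rw [bijSign_eq, inversionSign_eq_sign]
  congr 1
  rcases Int.units_eq_one_or (Equiv.Perm.sign σ) with h | h <;> simp [h, signHom_neg_one, opp_one_eq_neg_one]

lemma det_eq_matrix_det {α : Type*} [Fintype α] [LinearOrder α] (A : Matrix α α R) :
    det A = A.det := by
  let e := monoEquivOfFin α rfl
  rw [← det_submatrix_orderIso e e, det_eq_matrix_det_fin]
  exact Matrix.det_submatrix_equiv_self e.toEquiv A

lemma adj_eq_adjugate {n : ℕ} (A : Matrix (Fin n) (Fin n) R) : adj A = A.adjugate := by
  rcases n with _ | n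
  · exact Subsingleton.elim _ _
  ext i j
  rw [Matrix.adjugate_fin_succ_eq_det_submatrix, ← det_eq_matrix_det, adj, Matrix.of_apply,
    ← det_submatrix_orderIso (finSuccAboveOrderIso j) (finSuccAboveOrderIso i), add_comm]
  rfl

lemma trace_compound_eq_charpoly_coeff {n k : ℕ} (hk : k ≤ n) (A : Matrix (Fin n) (Fin n) R) :
    (compound A k).trace = (-1) ^ k * A.charpoly.coeff (n - k) := by
  have h := Matrix.charpoly_coeff_eq_sum_minors A k (by simpa using hk)
  rw [Fintype.card_fin] at h
  rw [h, ← mul_assoc, ← mul_pow, neg_one_mul, neg_neg, one_pow, one_mul, Matrix.trace]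
  rw [Finset.sum_subtype (p := fun I : Finset (Fin n) => I.card = k) _ (by simp)]
  refine Finset.sum_congr rfl fun I _ => ?_
  rw [Matrix.diag_apply, compound, Matrix.of_apply, det_eq_matrix_det]
  congr!

/-- Sums of principal minors are coefficients of the characteristic polynomial, and that of
`adj(E) A E` is that of `A E adj(E) = det(E) A`. -/
lemma trace_compound_adj_mul_mul {n k : ℕ} (hk : k ≤ n) (E A : Matrix (Fin n) (Fin n) R) :
    (compound (adj E * A * E) k).trace = det E ^ k * (compound A k).trace := by
  rw [← trace_compound_smul, trace_compound_eq_charpoly_coeff hk,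
    trace_compound_eq_charpoly_coeff hk, Matrix.mul_assoc, Matrix.charpoly_mul_comm,
    Matrix.mul_assoc, adj_eq_adjugate, Matrix.mul_adjugate, det_eq_matrix_det, Matrix.mul_smul,
    Matrix.mul_one]

end Ring

/-! ### Signed polynomials and cancellation -/

/-- Formal sums, with natural number coefficients, of signed elements of a monoid `G`. When `G`
is a monoid of monomials these are the polynomial expressions that can be evaluated in a semiring
with symmetry: `s` and `⊖s` are not allowed to cancel. -/
abbrev SignedSum (G : Type*) [CommMonoid G] : Type _ := MonoidAlgebra ℕ (ℤˣ × G)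

namespace SignedSum

variable {G : Type*} [CommMonoid G]

noncomputable instance : SemiringSymmetry (SignedSum G) where
  opp x := MonoidAlgebra.single (-1, 1) 1 * x
  opp_add := mul_add _
  opp_zero := mul_zero _
  opp_mul_right a b := mul_left_comm _ _ _
  opp_mul_left a b := (mul_assoc _ _ _).symm
  opp_opp a := by
    rw [← mul_assoc, MonoidAlgebra.single_mul_single, Prod.mk_mul_mk, mul_one, mul_one,
      Int.units_mul_self]
    exact one_mul a

lemma opp_def (x : SignedSum G) : opp x = MonoidAlgebra.single (-1, 1) 1 * x := rfl

lemma opp_one : opp (1 : SignedSum G) = MonoidAlgebra.single (-1, 1) 1 := mul_one _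

lemma signHom_eq (u : ℤˣ) : signHom (SignedSum G) u = MonoidAlgebra.single (u, 1) 1 := by
  rcases Int.units_eq_one_or u with rfl | rfl
  · exact map_one _
  · rw [signHom_neg_one, opp_one]

lemma coeff_opp (x : SignedSum G) (u : ℤˣ) (g : G) :
    (opp x).coeff (u, g) = x.coeff (-u, g) := by
  rw [opp_def, MonoidAlgebra.coeff_single_mul_eq_mul_coeff (-u, g), one_mul]
  rintro ⟨v, h⟩ -
  simp [Prod.ext_iff, neg_eq_iff_eq_neg]

/-- Evaluation of signed sums in a semiring with symmetry, the monomials being evaluated by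
`f`. -/
noncomputable def eval {S : Type*} [CommSemiring S] [SemiringSymmetry S] (f : G →* S) :
    SignedSum G →+* S :=
  (MonoidAlgebra.lift ℕ S (ℤˣ × G) ((signHom S).coprod f) : SignedSum G →+* S)

section Eval

variable {S : Type*} [CommSemiring S] [SemiringSymmetry S] (f : G →* S)

lemma eval_single (u : ℤˣ) (g : G) :
    eval f (MonoidAlgebra.single (u, g) 1) = signHom S u * f g := by
  simp [eval]

lemma eval_opp_one : eval f (opp 1) = opp 1 := by
  rw [opp_one, eval_single, signHom_neg_one, map_one, mul_one]

end Eval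

variable (G) in
/-- The canonical morphism to the ring `ℤ[G]`, where opposite terms cancel. -/
noncomputable def toRing : SignedSum G →+* MonoidAlgebra ℤ G := eval (MonoidAlgebra.of ℤ G)

lemma coeff_toRing (x : SignedSum G) (g : G) :
    (toRing G x).coeff g = x.coeff (1, g) - x.coeff (-1, g) := by
  classical
  induction x using MonoidAlgebra.induction_linear with
  | zero => simp
  | add x y hx hy =>
    rw [map_add, MonoidAlgebra.coeff_add, MonoidAlgebra.coeff_add, Finsupp.add_apply,
      Finsupp.add_apply, Finsupp.add_apply, hx, hy]
    push_cast
    ring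
  | single m r =>
    obtain ⟨u, h⟩ := m
    have : (MonoidAlgebra.single (u, h) r : SignedSum G) =
        r • MonoidAlgebra.single (u, h) 1 := by simp
    rw [this, map_nsmul, toRing, eval_single]
    rcases Int.units_eq_one_or u with rfl | rfl
    · simp [Finsupp.single_apply, Prod.ext_iff]
    · by_cases hg : h = g <;>
      simp [signHom_neg_one, opp_one_eq_neg_one, Prod.ext_iff, hg]

/-- Let `P` and `Q` agree in `ℤ[G]`. Then `P` dominates, up to a balanced term, the reduced form
`Q₀` of `Q` in which opposite terms have been cancelled; and `Q₀` retains every part `N` of `Q`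
whose monomials do not occur in `Q` with the opposite sign. -/
theorem exists_reduced {P Q N : SignedSum G} (hPQ : toRing G P = toRing G Q) (hNQ : NatLE N Q)
    (hN : ∀ u g, N.coeff (u, g) ≠ 0 → Q.coeff (-u, g) = 0) :
    ∃ Q₀, SuccCirc P Q₀ ∧ NatLE N Q₀ ∧ NatLE Q₀ Q := by
  classical
  have key (g : G) : P.coeff (1, g) + Q.coeff (-1, g) = P.coeff (-1, g) + Q.coeff (1, g) := by
    have h := coeff_toRing P g
    rw [hPQ, coeff_toRing Q g] at h
    omega
  let Q₀ : SignedSum G := .ofCoeff (Q.coeff - (opp Q).coeff)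
  have hQ₀ (u : ℤˣ) (g : G) : Q₀.coeff (u, g) = Q.coeff (u, g) - Q.coeff (-u, g) := by
    rw [← coeff_opp]
    rfl
  obtain ⟨D, hD⟩ := hNQ
  refine ⟨Q₀, ⟨.ofCoeff ((P.coeff - Q₀.coeff).filter fun p => p.1 = 1), ?_⟩,
    ⟨.ofCoeff (Q₀.coeff - N.coeff), ?_⟩, ⟨.ofCoeff (Q.coeff - Q₀.coeff), ?_⟩⟩
  · ext ⟨u, g⟩
    have := key g
    rw [circ, MonoidAlgebra.coeff_add, MonoidAlgebra.coeff_add, Finsupp.add_apply,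
      Finsupp.add_apply, coeff_opp, hQ₀]
    rcases Int.units_eq_one_or u with rfl | rfl
    · simp [hQ₀]
      omega
    · simp [hQ₀]
      omega
  · ext ⟨u, g⟩
    have h1 := hN u g
    have h2 : Q.coeff (u, g) = N.coeff (u, g) + D.coeff (u, g) := by rw [hD]; rfl
    rw [MonoidAlgebra.coeff_add, Finsupp.add_apply]
    simp only [Finsupp.tsub_apply, hQ₀]
    omega
  · ext ⟨u, g⟩
    rw [MonoidAlgebra.coeff_add, Finsupp.add_apply]
    simp only [Finsupp.tsub_apply, hQ₀]
    omega


section Support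

variable {x y : SignedSum G} {p : ℤˣ × G}

lemma exists_coeff_ne_zero_of_sum {ι : Type*} {s : Finset ι} {f : ι → SignedSum G}
    (h : (∑ i ∈ s, f i).coeff p ≠ 0) : ∃ i ∈ s, (f i).coeff p ≠ 0 := by
  rw [MonoidAlgebra.coeff_sum, Finsupp.finsetSum_apply] at h
  exact Finset.exists_ne_zero_of_sum_ne_zero h

lemma eq_of_coeff_single_ne_zero {X : Type*} {p q : X} {r : ℕ}
    (h : (MonoidAlgebra.single q r).coeff p ≠ 0) : p = q := by
  by_contra hpq
  exact h (Finsupp.single_eq_of_ne hpq)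

lemma exists_coeff_ne_zero_of_mul (h : (x * y).coeff p ≠ 0) :
    ∃ a b, x.coeff a ≠ 0 ∧ y.coeff b ≠ 0 ∧ a * b = p := by
  classical
  have := MonoidAlgebra.support_coeff_mul_subset x y (Finsupp.mem_support_iff.2 h)
  obtain ⟨a, ha, b, hb, hab⟩ := Finset.mem_mul.1 this
  exact ⟨a, b, Finsupp.mem_support_iff.1 ha, Finsupp.mem_support_iff.1 hb, hab⟩

end Support

end SignedSum

/-! ### Generic matrices -/

section Generic

/-- Monomials in `n × n` commuting variables, written multiplicatively. -/
abbrev Monomial (n : ℕ) : Type := Multiplicative (Fin n × Fin n → ℕ)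

variable {n : ℕ}

namespace Monomial

/-- The variable in position `p`. -/
def var (p : Fin n × Fin n) : Monomial n := Multiplicative.ofAdd (Pi.single p 1)

/-- Evaluation of monomials at the entries of a matrix. -/
def eval {S : Type*} [CommSemiring S] (A : Matrix (Fin n) (Fin n) S) : Monomial n →* S where
  toFun m := ∏ p, A p.1 p.2 ^ m.toAdd p
  map_one' := by simp
  map_mul' a b := by simp [pow_add, Finset.prod_mul_distrib]

lemma eval_var {S : Type*} [CommSemiring S] (A : Matrix (Fin n) (Fin n) S)
    (p : Fin n × Fin n) : eval A (var p) = A p.1 p.2 := by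
  simp [eval, var, Pi.single_apply, pow_ite, Finset.prod_ite_eq']

/-- The product of the variables on the graph of a bijection between two sets, whose elements are
regarded as row and column indices by means of `r` and `c`. -/
def graph {α β : Type*} [Fintype α] (r : α → Fin n) (c : β → Fin n) (σ : α ≃ β) : Monomial n :=
  ∏ i, var (r i, c (σ i))

lemma toAdd_graph_ne_zero {α β : Type*} [Fintype α] {r : α → Fin n} {c : β → Fin n} {σ : α ≃ β}
    {a b : Fin n} : (graph r c σ).toAdd (a, b) ≠ 0 ↔ ∃ i, r i = a ∧ c (σ i) = b := by
  simp only [graph, toAdd_prod, var, toAdd_ofAdd, Finset.sum_apply, ne_eq,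
    Finset.sum_eq_zero_iff, Finset.mem_univ, true_imp_iff, not_forall]
  refine exists_congr fun i => ?_
  simp [Pi.single_apply, Prod.ext_iff, eq_comm]

/-- A principal minor has no two terms of opposite sign with the same monomial, and neither do
two distinct principal minors. -/
lemma inversionSign_eq_of_graph_eq {I J : Finset (Fin n)} {σ : I ≃ I} {τ : J ≃ J}
    (h : graph Subtype.val Subtype.val σ = graph Subtype.val Subtype.val τ) :
    inversionSign σ = inversionSign τ := by
  have key (a b : Fin n) : (∃ i : I, i.1 = a ∧ (σ i).1 = b) ↔ ∃ j : J, j.1 = a ∧ (τ j).1 = b := by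
    rw [← toAdd_graph_ne_zero, h, toAdd_graph_ne_zero]
  obtain rfl : I = J := by
    ext a
    constructor
    · intro ha
      obtain ⟨j, rfl, -⟩ := (key a _).1 ⟨⟨a, ha⟩, rfl, rfl⟩
      exact j.2
    · intro ha
      obtain ⟨i, rfl, -⟩ := (key a _).2 ⟨⟨a, ha⟩, rfl, rfl⟩
      exact i.2
  congr 1
  ext i
  obtain ⟨j, hj, hij⟩ := (key i.1 (σ i).1).1 ⟨i, rfl, rfl⟩
  rw [← hij, Subtype.ext hj]

end Monomial

open SignedSum

variable {G : Type*} [CommMonoid G]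

/-- The matrix of variables, embedded in a larger monoid of monomials along `ι`. -/
noncomputable def genericMatrix (ι : Monomial n →* G) : Matrix (Fin n) (Fin n) (SignedSum G) :=
  Matrix.of fun i j => MonoidAlgebra.single (1, ι (Monomial.var (i, j))) 1

lemma genericMatrix_map_eval {S : Type*} [CommSemiring S] [SemiringSymmetry S]
    (ι : Monomial n →* G) (f : G →* S) (A : Matrix (Fin n) (Fin n) S)
    (hf : f.comp ι = Monomial.eval A) : (genericMatrix ι).map (eval f) = A := by
  ext i j
  rw [Matrix.map_apply, genericMatrix, Matrix.of_apply, eval_single, map_one, one_mul,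
    ← MonoidHom.comp_apply, hf, Monomial.eval_var]

lemma det_genericMatrix_submatrix (ι : Monomial n →* G) {α β : Type*} [Fintype α] [LinearOrder α]
    [Fintype β] [LinearOrder β] (r : α → Fin n) (c : β → Fin n) :
    det ((genericMatrix ι).submatrix r c) =
      ∑ σ, MonoidAlgebra.single (inversionSign σ, ι (Monomial.graph r c σ)) 1 := by
  refine Finset.sum_congr rfl fun σ _ => ?_
  have h : ∏ i, (genericMatrix ι).submatrix r c i (σ i) =
      MonoidAlgebra.of ℕ (ℤˣ × G) (1, ι (Monomial.graph r c σ)) := by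
    rw [Monomial.graph, map_prod, ← MonoidHom.inr_apply, ← MonoidHom.comp_apply, map_prod]
    rfl
  rw [h, bijSign_eq, signHom_eq, MonoidAlgebra.of_apply, MonoidAlgebra.single_mul_single]
  simp

variable (n) in
/-- The monomials in the entries of two generic `n × n` matrices. -/
abbrev PairMonomial : Type := Monomial n × Monomial n

variable (n) in
/-- The first generic matrix. -/
noncomputable abbrev genericFst : Matrix (Fin n) (Fin n) (SignedSum (PairMonomial n)) :=
  genericMatrix (MonoidHom.inl _ _)

variable (n) in
/-- The second generic matrix. -/
noncomputable abbrev genericSnd : Matrix (Fin n) (Fin n) (SignedSum (PairMonomial n)) :=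
  genericMatrix (MonoidHom.inr _ _)

lemma det_genericFst : det (genericFst n) = ∑ σ : Fin n ≃ Fin n,
    MonoidAlgebra.single (inversionSign σ, (Monomial.graph id id σ, 1)) 1 :=
  det_genericMatrix_submatrix _ id id

/-- Among the terms of `det ^ k`, those whose variables all lie on the graph of `σ` come from
`k` copies of the term of `σ`. This determines their sign, although `det ^ k` does have pairs of
opposite terms in general. -/
lemma coeff_det_genericFst_pow_ne_zero (σ : Fin n ≃ Fin n) (k : ℕ) {u : ℤˣ} {m : PairMonomial n}
    (h : (det (genericFst n) ^ k).coeff (u, m) ≠ 0) :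
    m.2 = 1 ∧ ((∀ i j, m.1.toAdd (i, j) ≠ 0 → j = σ i) → u = inversionSign σ ^ k) := by
  induction k generalizing u m with
  | zero =>
    rw [pow_zero, MonoidAlgebra.one_def] at h
    have := eq_of_coeff_single_ne_zero h
    simp only [Prod.ext_iff, Prod.fst_one, Prod.snd_one] at this
    simp [this]
  | succ k ih =>
    rw [pow_succ] at h
    obtain ⟨⟨v, a⟩, q, hv, hq, hm⟩ := exists_coeff_ne_zero_of_mul h
    rw [det_genericFst] at hq
    obtain ⟨τ, -, hq⟩ := exists_coeff_ne_zero_of_sum hq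
    obtain rfl := eq_of_coeff_single_ne_zero hq
    obtain ⟨h1, h2⟩ := ih hv
    obtain ⟨rfl, rfl⟩ := Prod.ext_iff.1 hm
    refine ⟨by simpa using h1, fun hs => ?_⟩
    have hs' (i j : Fin n) : a.1.toAdd (i, j) ≠ 0 ∨
        (Monomial.graph id id τ).toAdd (i, j) ≠ 0 → j = σ i := by
      intro hij
      refine hs i j ?_
      simp only [Prod.mk_mul_mk, Prod.fst_mul, toAdd_mul, Pi.add_apply]
      omega
    obtain rfl : τ = σ := by
      ext i
      exact congrArg _ (hs' i (τ i) (.inr (Monomial.toAdd_graph_ne_zero.2 ⟨i, rfl, rfl⟩)))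
    rw [pow_succ, ← h2 fun i j hij => hs' i j (.inl hij)]
    rfl

lemma coeff_trace_compound_genericSnd_ne_zero {k : ℕ} {u : ℤˣ} {m : PairMonomial n}
    (h : (compound (genericSnd n) k).trace.coeff (u, m) ≠ 0) :
    ∃ (I : Finset (Fin n)) (σ : I ≃ I),
      u = inversionSign σ ∧ m = (1, Monomial.graph Subtype.val Subtype.val σ) := by
  obtain ⟨I, -, h⟩ := exists_coeff_ne_zero_of_sum h
  rw [Matrix.diag_apply, compound, Matrix.of_apply, det_genericMatrix_submatrix] at h
  obtain ⟨σ, -, h⟩ := exists_coeff_ne_zero_of_sum h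
  exact ⟨I.1, σ, Prod.ext_iff.1 (eq_of_coeff_single_ne_zero h)⟩

/-- The terms of `det ^ k * trace` made of the `k`-th power of a single term of `det` are not
cancelled. -/
lemma coeff_det_pow_mul_trace_eq_zero (σ : Fin n ≃ Fin n) (k : ℕ) {u : ℤˣ} {m : PairMonomial n}
    (h : (MonoidAlgebra.single (inversionSign σ, (Monomial.graph id id σ, 1)) 1 ^ k *
      (compound (genericSnd n) k).trace).coeff (u, m) ≠ 0) :
    (det (genericFst n) ^ k * (compound (genericSnd n) k).trace).coeff (-u, m) = 0 := by
  by_contra h'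
  obtain ⟨p, ⟨v, a⟩, hp, hv, hm⟩ := exists_coeff_ne_zero_of_mul h
  obtain ⟨⟨u', b⟩, ⟨v', a'⟩, hu', hv', hm'⟩ := exists_coeff_ne_zero_of_mul h'
  rw [MonoidAlgebra.single_pow] at hp
  obtain rfl := eq_of_coeff_single_ne_zero hp
  obtain ⟨I, τ, rfl, rfl⟩ := coeff_trace_compound_genericSnd_ne_zero hv
  obtain ⟨J, τ', rfl, rfl⟩ := coeff_trace_compound_genericSnd_ne_zero hv'
  obtain ⟨b1, b2⟩ := coeff_det_genericFst_pow_ne_zero σ k hu'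
  simp only [Prod.ext_iff, Prod.mk_mul_mk, Prod.pow_mk, Prod.fst_mul, Prod.snd_mul, mul_one,
    one_pow, one_mul] at hm hm'
  obtain ⟨rfl, hm1, hm2⟩ := hm
  obtain ⟨hu, hb1, hb2⟩ := hm'
  rw [b1, one_mul, ← hm2] at hb2
  rw [b2, Monomial.inversionSign_eq_of_graph_eq hb2] at hu
  · exact absurd hu (by simp)
  · intro i j hij
    rw [hb1, ← hm1, toAdd_pow, Pi.smul_apply] at hij
    obtain ⟨i', rfl, rfl⟩ := Monomial.toAdd_graph_ne_zero.1 (right_ne_zero_of_smul hij)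
    rfl

end Generic

/-! ### Nonsingular matrices over extended tropical semirings -/

section Tropical

lemma natLE_add_pow {S : Type*} [CommSemiring S] (a b : S) (k : ℕ) :
    NatLE (a ^ k) ((a + b) ^ k) := by
  induction k with
  | zero => exact ⟨0, by simp⟩
  | succ k ih =>
    obtain ⟨c, hc⟩ := ih
    exact ⟨a ^ k * b + c * (a + b), by rw [pow_succ, hc]; ring⟩

lemma IsTotallyOrderedIdempotent.exists_sum_eq {M : Type*} [Semifield M]
    (hM : IsTotallyOrderedIdempotent M) {ι : Type*} {s : Finset ι} (hs : s.Nonempty)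
    (f : ι → M) : ∃ i ∈ s, ∑ j ∈ s, f j = f i := by
  classical
  have hmax (a b : M) : a + b = a ∨ a + b = b := by
    rcases hM.total a b with ⟨c, rfl⟩ | ⟨c, rfl⟩
    · right
      rw [← add_assoc, hM.add_self]
    · left
      rw [add_right_comm, hM.add_self]
  induction hs using Finset.Nonempty.cons_induction with
  | singleton i => exact ⟨i, by simp⟩
  | cons i s hi hs ih =>
    obtain ⟨j, hj, h⟩ := ih
    rw [Finset.sum_cons, h]
    rcases hmax (f i) (f j) with h | h
    · exact ⟨i, by simp, h⟩
    · exact ⟨j, by simp [hj], h⟩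

variable {T M : Type*} [CommSemiring T] [SemiringSymmetry T] [Semifield M] {μ : T →+* M} {n : ℕ}

/-- A term of maximal modulus of an invertible determinant is equal to the determinant. -/
lemma IsExtendedTropical.exists_term_eq_det (hT : IsExtendedTropical μ)
    {E : Matrix (Fin n) (Fin n) T} (hE : Nonsingular E) :
    ∃ σ : Fin n ≃ Fin n, signHom T (inversionSign σ) * ∏ i, E i (σ i) = det E := by
  classical
  obtain ⟨σ, -, hσ⟩ := hT.semifield.exists_sum_eq (Finset.univ_nonempty (α := Fin n ≃ Fin n))
    fun σ => μ (bijSign T σ * ∏ i, E i (σ i))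
  refine ⟨σ, ?_⟩
  rw [← bijSign_eq]
  refine hT.thin _ _ ⟨_, (Finset.add_sum_erase _ _ (Finset.mem_univ σ)).symm⟩ ?_ (.inl hE)
  rw [← hσ, det, map_sum]

/-- The inequality before division by `det E ^ k`. -/
theorem IsExtendedTropical.succCirc_trace_compound_adj (hT : IsExtendedTropical μ)
    {E : Matrix (Fin n) (Fin n) T} (hE : Nonsingular E) (A : Matrix (Fin n) (Fin n) T) {k : ℕ}
    (hk : k ≤ n) :
    SuccCirc (compound (adj E * A * E) k).trace (det E ^ k * (compound A k).trace) := by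
  classical
  obtain ⟨σ, hσ⟩ := hT.exists_term_eq_det hE
  let f : PairMonomial n →* T := (Monomial.eval E).coprod (Monomial.eval A)
  have hX : (genericFst n).map (SignedSum.eval f) = E :=
    genericMatrix_map_eval _ _ _ (MonoidHom.coprod_comp_inl _ _)
  have hY : (genericSnd n).map (SignedSum.eval f) = A :=
    genericMatrix_map_eval _ _ _ (MonoidHom.coprod_comp_inr _ _)
  have hf : SignedSum.eval f (opp 1) = opp 1 := SignedSum.eval_opp_one f
  have hr := SignedSum.eval_opp_one (MonoidAlgebra.of ℤ (PairMonomial n))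
  let t : SignedSum (PairMonomial n) :=
    MonoidAlgebra.single (inversionSign σ, (Monomial.graph id id σ, 1)) 1
  have ht : SignedSum.eval f t = det E := by
    rw [SignedSum.eval_single, ← hσ]
    simp [f, Monomial.graph, Monomial.eval_var]
  have hle : NatLE (t ^ k * (compound (genericSnd n) k).trace)
      (det (genericFst n) ^ k * (compound (genericSnd n) k).trace) := by
    rw [det_genericFst, ← Finset.add_sum_erase _ _ (Finset.mem_univ σ)]
    obtain ⟨c, hc⟩ := natLE_add_pow t (∑ τ ∈ Finset.univ.erase σ,
      MonoidAlgebra.single (inversionSign τ, (Monomial.graph id id τ, 1)) 1) k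
    exact ⟨c * (compound (genericSnd n) k).trace, by rw [hc, add_mul]⟩
  obtain ⟨Q, ⟨c, hc⟩, ⟨a, ha⟩, ⟨b, hb⟩⟩ := SignedSum.exists_reduced
    (P := (compound (adj (genericFst n) * genericSnd n * genericFst n) k).trace)
    (by
      rw [map_mul, map_pow, SignedSum.toRing, map_det _ hr, map_trace_compound _ hr,
        map_trace_compound _ hr, Matrix.map_mul, Matrix.map_mul, map_adj _ hr,
        trace_compound_adj_mul_mul hk])
    hle fun u m => coeff_det_pow_mul_trace_eq_zero σ k
  have hQ : SignedSum.eval f Q = det E ^ k * (compound A k).trace := by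
    -- Both `t ^ k * trace` and `det ^ k * trace` evaluate to the right-hand side.
    refine hT.naturallyOrdered _ _ ⟨SignedSum.eval f b, ?_⟩ ⟨SignedSum.eval f a, ?_⟩
    · rw [← map_add, ← hb, map_mul, map_pow, map_det _ hf, map_trace_compound _ hf, hX, hY]
    · rw [ha, map_add, map_mul, map_pow, ht, map_trace_compound _ hf, hY]
  refine ⟨SignedSum.eval f c, ?_⟩
  rw [← hQ, ← map_circ _ hf, ← map_add, ← hc, map_trace_compound _ hf, Matrix.map_mul,
    Matrix.map_mul, map_adj _ hf, hX, hY]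

end Tropical

end TropicalCompound

open TropicalCompound in
theorem theorem4p6 {T M : Type*} [CommSemiring T] [SemiringSymmetry T] [Semifield M]
    (μ : T →+* M) (hT : IsExtendedTropical μ) {n : ℕ}
    (E A : Matrix (Fin n) (Fin n) T) (hE : Nonsingular E) (k : ℕ) (hk : 1 ≤ k) (hkn : k ≤ n) :
    SuccCirc (Matrix.trace (compound (quasiInverse E hE * A * E) k))
      (Matrix.trace (compound A k)) := by
  obtain ⟨c, hc⟩ := hT.succCirc_trace_compound_adj hE A hkn
  let d : T := ((IsUnit.unit hE)⁻¹ : Tˣ)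
  have hd : d * det E = 1 := IsUnit.val_inv_mul hE
  have hq : quasiInverse E hE = d • adj E := by
    ext i j
    exact mul_comm _ _
  refine ⟨d ^ k * c, ?_⟩
  rw [hq, Matrix.smul_mul, Matrix.smul_mul, trace_compound_smul, hc, mul_add, ← mul_assoc,
    ← mul_pow, hd, one_pow, one_mul, mul_circ]
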